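/- Let $\mathbb{F}_q$ be a finite field of characteristic at least $5$, and let $K$ be a cubic function field over $\mathbb{F}_q$, i.e. a field extension of $\mathbb{F}_q(t)$ of degree $3$. Let $\mathcal{O}_K$ be the integral closure of $\mathbb{F}_q[t]$ in $K$, and suppose that $K$ has unit rank $2$, i.e. that $\mathcal{O}_K^*$ modulo its torsion subgroup has rank $2$. Let $D \in \mathbb{F}_q[t]$ be the discriminant of $K$, that is, the discriminant of any $\mathbb{F}_q[t]$-basis of $\mathcal{O}_K$ (it is unique up to squares in $\mathbb{F}_q^*$). Let $R$ be the regulator of $K$, that is, \[ R = \left| \det \begin{pmatrix} \deg(\varepsilon_1^{(i)}) & \deg(\varepsilon_1^{(j)}) \\ \deg(\varepsilon_2^{(i)}) & \deg(\varepsilon_2^{(j)}) \end{pmatrix} \right|, \] where $\{\varepsilon_1, \varepsilon_2\}$ is a system of fundamental units of $K$ (a basis of $\mathcal{O}_K^*$ modulo torsion), $\alpha \mapsto \alpha^{(i)}$ and $\alpha \mapsto \alpha^{(j)}$ are two distinct $\mathbb{F}_q(t)$-embeddings of $K$ into the field $\mathbb{F}_q\langle t^{-1}\rangle$ of Laurent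 series in $t^{-1}$ (the completion of $\mathbb{F}_q(t)$ at the infinite place), and $\deg\left(\sum_{k \ge m} a_k t^{-k}\right) = -m$ if $a_m \neq 0$; the value of $R$ does not depend on these choices. Then \[ R \;\geq\; \frac{1}{16}\,(\deg D)^2 . \] -/

import Mathlib

open scoped Polynomial RatFunc

namespace CubicFunctionField

noncomputable section

open Classical in
/-- The field `F⟨t⁻¹⟩` of Laurent series in `t⁻¹`, as the completion of `F(t)` at the infinite
place. -/
abbrev LaurentInfty (F : Type*) [Field F] : Type _ := RatFunc.CompletionAtInfty F

/-- The degree `-m` of a nonzero series `∑_{i ≥ m} aᵢ t⁻ⁱ` (with `a_m ≠ 0`) in the completion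
`F⟨t⁻¹⟩` of `F(t)` at the infinite place; it extends the degree of rational functions.
The value at `0` is the junk value `0`. -/
def degAtInfty {F : Type*} [Field F] (x : LaurentInfty F) : ℤ :=
  WithZero.log (Valued.v x : WithZero (Multiplicative ℤ))

/-- The degree at infinity extends the degree (numerator minus denominator) of `F(t)`. -/
theorem degAtInfty_algebraMap {F : Type*} [Field F] (x : F⟮X⟯) :
    degAtInfty (algebraMap F⟮X⟯ (LaurentInfty F) x) = x.intDegree := by
  classical
  by_cases hx : x = 0
  · simp [hx, degAtInfty]
  · have h : (Valued.v (algebraMap F⟮X⟯ (LaurentInfty F) x) : WithZero (Multiplicative ℤ))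
        = RatFunc.inftyValuationDef F x := by
      rw [RatFunc.valuedCompletionAtInfty.def]
      let _ := RatFunc.inftyValued F
      exact Valued.extensionValuation_apply_coe (K := F⟮X⟯) x
    rw [degAtInfty, h, RatFunc.inftyValuationDef, if_neg hx, WithZero.log_exp]

section

variable (F K : Type*) [Field F] [Field K] [Algebra F[X] K]

/-- The unit group `𝒪_Kˣ` of the maximal order, the integral closure of `F[t]` in `K`. -/
abbrev UnitGroup : Type _ := (FunctionField.ringOfIntegers F K)ˣ

/-- The unit rank of `K`: the rank of the free part `𝒪_Kˣ / torsion` of the unit group. -/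
def unitRank : ℕ :=
  Module.finrank ℤ (Additive (UnitGroup F K ⧸ CommGroup.torsion (UnitGroup F K)))

variable {F K} in
/-- `ε` is a system of fundamental units: every unit is, in exactly one way, a torsion unit times
a product of integer powers of the `ε i`. -/
def IsFundamentalSystem {r : ℕ} (ε : Fin r → UnitGroup F K) : Prop :=
  ∀ u : UnitGroup F K, ∃! p : CommGroup.torsion (UnitGroup F K) × (Fin r → ℤ),
    u = (p.1 : UnitGroup F K) * ∏ i, ε i ^ p.2 i

variable [Algebra F⟮X⟯ K]

/-- `D` is a discriminant of `K / F(t)`: the discriminant of some integral basis, that is, of some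
`F[t]`-basis of the maximal order. It is unique up to squares of nonzero constants. -/
def IsDiscriminant (D : F[X]) : Prop :=
  ∃ b : Module.Basis (Fin (Module.finrank F⟮X⟯ K)) F[X] (FunctionField.ringOfIntegers F K),
    D = Algebra.discr F[X] b

variable {F K} in
/-- The matrix of degrees of the conjugates of two units `ε 0`, `ε 1` under two conjugate
mappings `σ 0`, `σ 1` of `K` into the field of Laurent series in `t⁻¹`. -/
def degreeMatrix (ε : Fin 2 → UnitGroup F K) (σ : Fin 2 → (K →ₐ[F⟮X⟯] LaurentInfty F)) :
    Matrix (Fin 2) (Fin 2) ℤ :=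
  Matrix.of fun i j => degAtInfty (σ j ((ε i : FunctionField.ringOfIntegers F K) : K))

/-- `R` is the absolute value of the determinant of the matrix of degrees of two fundamental units
under two distinct conjugate mappings. -/
def IsRegulator (R : ℤ) : Prop :=
  ∃ (ε : Fin 2 → UnitGroup F K) (σ : Fin 2 → (K →ₐ[F⟮X⟯] LaurentInfty F)),
    IsFundamentalSystem ε ∧ σ 0 ≠ σ 1 ∧ R = |(degreeMatrix ε σ).det|

open Classical in
/-- The regulator of a cubic function field of unit rank two. For such a field there is exactly one
`R` with `IsRegulator F K R`. The fallback value is `0`. -/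
def regulator : ℤ :=
  if h : ∃ R, IsRegulator F K R then h.choose else 0

end

end

end CubicFunctionField

namespace CubicFunctionField

/-! The bound comes from a gap in the lattice of unit degrees, combined with Minkowski's convex body
theorem.

Unit rank two forces the infinite place to split completely. Otherwise two embeddings into an
algebraic closure of `LaurentInfty F` would be Galois conjugate and have equal valuations. As a unit
has constant norm, one integer-valued degree would then detect torsion, and the rank would be at
most one (`mem_range_of_unitRank_eq_two`).

So each unit u has three degrees x, y, z with x + y + z = 0. If u is not torsion, its conjugates are
distinct and the discriminant of 1, u, u² is a nonzero square times D. Bounding each difference of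
conjugates by the larger degree gives deg D ≤ 2(max(x,y) + max(x,z) + max(y,z)), and this is
2(largest − smallest) because the sum is zero (`natDegree_discr_le`).

Hence the lattice of points (x − z, y − z), of covolume 3R, has no nonzero point in the hexagon of
size m = deg D / 2, whose area is 3m². Minkowski gives 3m² ≤ 4 · 3R, that is R ≥ (deg D)² / 16. -/

instance completeSpace_laurentInfty (F : Type*) [Field F] : CompleteSpace (LaurentInfty F) := by
  classical
  let _ := RatFunc.inftyValued F
  let _ : UniformSpace F⟮X⟯ := (RatFunc.inftyValued F).toUniformSpace
  exact inferInstanceAs (CompleteSpace (UniformSpace.Completion F⟮X⟯))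

/-! ### Extending the infinite valuation to an algebraic closure -/

open scoped NNReal Valued in
/-- A complete rank one valuation extends, invariantly under automorphisms, to an algebraic
closure. -/
theorem exists_valuation_algebraicClosure_of_rankOne (L : Type*) [Field L] {Γ₀ : Type*}
    [LinearOrderedCommGroupWithZero Γ₀] [val : Valued L Γ₀] [CompleteSpace L]
    [Valuation.RankOne val.v] :
    ∃ W : Valuation (AlgebraicClosure L) ℝ≥0,
      (∀ x : L, W (algebraMap _ _ x) ≤ 1 ↔ val.v x ≤ 1) ∧
      ∀ (g : Gal(AlgebraicClosure L/L)) x, W (g x) = W x := by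
  -- The extension is the spectral norm. Completeness makes it multiplicative, and it depends only
  -- on the minimal polynomial, hence the Galois invariance.
  refine ⟨⟨⟨⟨fun x => ⟨spectralNorm L (AlgebraicClosure L) x, spectralNorm_nonneg x⟩, ?_⟩, ?_, ?_⟩,
    ?_⟩, ?_, ?_⟩
  · ext; exact spectralNorm_zero
  · ext; exact spectralNorm_one
  · intro x y; ext; exact spectralAlgNorm_mul x y
  · intro x y; exact isNonarchimedean_spectralNorm x y
  · intro x
    change spectralNorm L (AlgebraicClosure L) (algebraMap _ _ x) ≤ 1 ↔ _
    rw [spectralNorm_extends]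
    exact Valued.toNormedField.norm_le_one_iff
  · intro g x
    ext
    exact (spectralNorm_eq_of_equiv g x).symm

-- The real scale of a rank one valuation is not canonical. Comparing unit balls is enough, since
-- the extension serves only to test integrality at infinity and equality of conjugate valuations.
open scoped NNReal in
theorem exists_valuation_algebraicClosure (F : Type*) [Field F] :
    ∃ W : Valuation (AlgebraicClosure (LaurentInfty F)) ℝ≥0,
      (∀ x : LaurentInfty F, W (algebraMap _ _ x) ≤ 1 ↔
        (Valued.v x : WithZero (Multiplicative ℤ)) ≤ 1) ∧
      ∀ (g : Gal(AlgebraicClosure (LaurentInfty F)/LaurentInfty F)) x, W (g x) = W x := by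
  classical
  have hnt : (Valued.v : Valuation (LaurentInfty F) (WithZero (Multiplicative ℤ))).IsNontrivial := by
    refine ⟨algebraMap F⟮X⟯ (LaurentInfty F) RatFunc.X, ?_, ?_⟩
    · simp [RatFunc.X_ne_zero]
    · intro h
      have := degAtInfty_algebraMap (F := F) RatFunc.X
      rw [degAtInfty, h] at this
      simp at this
  obtain ⟨hr⟩ : Nonempty (Valuation.RankOne
      (Valued.v : Valuation (LaurentInfty F) (WithZero (Multiplicative ℤ)))) := by
    rw [Valuation.nonempty_rankOne_iff_mulArchimedean]
    infer_instance
  exact exists_valuation_algebraicClosure_of_rankOne (LaurentInfty F)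

/-- The coefficients of a monic polynomial lie in every subring that contains its roots. -/
theorem coeff_mem_of_roots_mem {L : Type*} [Field L] (V : Subring L) {p : L[X]} (hp : p.Monic)
    (hs : p.Splits) (h : ∀ r ∈ p.roots, r ∈ V) (i : ℕ) : p.coeff i ∈ V := by
  have hmem : p ∈ Polynomial.lifts V.subtype := by
    rw [hs.eq_prod_roots_of_monic hp]
    refine Subsemiring.multiset_prod_mem _ _ fun q hq => ?_
    obtain ⟨r, hr, rfl⟩ := Multiset.mem_map.1 hq
    exact ⟨Polynomial.X - Polynomial.C ⟨r, h r hr⟩, by simp⟩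
  obtain ⟨a, ha⟩ := (Polynomial.lifts_iff_coeff_lifts p).1 hmem i
  exact ha ▸ a.2

/-! ### The degree function and separability -/

section Degree

variable {F : Type*} [Field F]

theorem degAtInfty_mul {x y : LaurentInfty F} (hx : x ≠ 0) (hy : y ≠ 0) :
    degAtInfty (x * y) = degAtInfty x + degAtInfty y := by
  rw [degAtInfty, map_mul, WithZero.log_mul ((Valuation.ne_zero_iff _).2 hx)
    ((Valuation.ne_zero_iff _).2 hy)]
  rfl

theorem valuation_le_exp_iff {x : LaurentInfty F} (hx : x ≠ 0) (n : ℤ) :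
    (Valued.v x : WithZero (Multiplicative ℤ)) ≤ WithZero.exp n ↔ degAtInfty x ≤ n := by
  rw [degAtInfty, ← WithZero.log_le_iff_le_exp ((Valuation.ne_zero_iff _).2 hx)]

theorem valuation_le_one_iff {x : LaurentInfty F} (hx : x ≠ 0) :
    (Valued.v x : WithZero (Multiplicative ℤ)) ≤ 1 ↔ degAtInfty x ≤ 0 := by
  rw [← valuation_le_exp_iff hx, WithZero.exp_zero]

theorem degAtInfty_sub_le {x y : LaurentInfty F} (hx : x ≠ 0) (hy : y ≠ 0) (hxy : x ≠ y) :
    degAtInfty (x - y) ≤ max (degAtInfty x) (degAtInfty y) := by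
  rw [← valuation_le_exp_iff (sub_ne_zero.2 hxy)]
  refine (Valuation.map_sub _ x y).trans (max_le ?_ ?_)
  · exact (valuation_le_exp_iff hx _).2 (le_max_left _ _)
  · exact (valuation_le_exp_iff hy _).2 (le_max_right _ _)

theorem degAtInfty_polynomial (p : F[X]) :
    degAtInfty (algebraMap F⟮X⟯ (LaurentInfty F) (algebraMap F[X] F⟮X⟯ p)) = p.natDegree := by
  rw [degAtInfty_algebraMap, RatFunc.intDegree_polynomial]

theorem isSeparable_of_finrank_eq_three {K : Type*} [Field K] [Algebra F⟮X⟯ K]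
    (hchar : 5 ≤ ringChar F)
    (hcubic : Module.finrank F⟮X⟯ K = 3) : Algebra.IsSeparable F⟮X⟯ K := by
  have : FiniteDimensional F⟮X⟯ K := .of_finrank_pos (by omega)
  have : CharP F⟮X⟯ (ringChar F) := charP_of_injective_algebraMap (algebraMap F _).injective _
  refine ⟨fun x => ?_⟩
  have hx : IsIntegral F⟮X⟯ x := Algebra.IsIntegral.isIntegral x
  refine (Polynomial.separable_iff_derivative_ne_zero (minpoly.irreducible hx)).2 fun h => ?_
  have hle : (minpoly F⟮X⟯ x).natDegree ≤ 3 := hcubic ▸ minpoly.natDegree_le x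
  have hpos := minpoly.natDegree_pos hx
  -- The top coefficient of the derivative of the minimal polynomial is its degree, which lies
  -- between 1 and 3 and so is nonzero in characteristic at least 5.
  have hc := congrArg (fun p => p.coeff ((minpoly F⟮X⟯ x).natDegree - 1)) h
  simp only [Polynomial.coeff_derivative, Polynomial.coeff_zero] at hc
  rw [Nat.sub_add_cancel hpos, (minpoly.monic hx).coeff_natDegree, one_mul,
    ← Nat.cast_add_one, Nat.sub_add_cancel hpos, CharP.cast_eq_zero_iff F⟮X⟯ (ringChar F)] at hc
  have := Nat.le_of_dvd hpos hc
  omega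

end Degree

/-! ### Norms of units and the detection of torsion -/

section Units

variable {F K : Type*} [Field F] [Field K] [Algebra F[X] K]

variable [Algebra F⟮X⟯ K]

/-- The degree of a unit under a conjugate mapping, as a homomorphism. -/
noncomputable def unitDegree (σ : K →ₐ[F⟮X⟯] LaurentInfty F) : UnitGroup F K →* Multiplicative ℤ where
  toFun u := .ofAdd (degAtInfty (σ ((u : FunctionField.ringOfIntegers F K) : K)))
  map_one' := by simp [degAtInfty]
  map_mul' u w := by
    simp only [Units.val_mul, MulMemClass.coe_mul, map_mul]
    rw [degAtInfty_mul (by simp) (by simp), ofAdd_add]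

variable [IsScalarTower F[X] F⟮X⟯ K]

theorem exists_norm_eq_C [FiniteDimensional F⟮X⟯ K] (u : UnitGroup F K) :
    ∃ c : F, c ≠ 0 ∧ Algebra.norm F⟮X⟯ ((u : FunctionField.ringOfIntegers F K) : K) =
      algebraMap F[X] F⟮X⟯ (Polynomial.C c) := by
  have key (w : UnitGroup F K) : ∃ p : F[X], algebraMap F[X] F⟮X⟯ p =
      Algebra.norm F⟮X⟯ ((w : FunctionField.ringOfIntegers F K) : K) :=
    IsIntegrallyClosed.isIntegral_iff.1 (Algebra.isIntegral_norm _ (w : _).1.2)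
  obtain ⟨p, hp⟩ := key u
  obtain ⟨q, hq⟩ := key u⁻¹
  have hpq : p * q = 1 := by
    apply IsFractionRing.injective F[X] F⟮X⟯
    rw [map_mul, hp, hq, ← map_mul, ← MulMemClass.coe_mul, Units.mul_inv]
    simp
  obtain ⟨c, hc, rfl⟩ := Polynomial.isUnit_iff.1 (IsUnit.of_mul_eq_one q hpq)
  exact ⟨c, hc.ne_zero, hp.symm⟩

open scoped NNReal

/-- A unit all of whose conjugates have valuation at most one is a root of unity. -/
theorem mem_torsion_of_valuation_le_one [Finite F] [FiniteDimensional F⟮X⟯ K]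
    (W : Valuation (AlgebraicClosure (LaurentInfty F)) ℝ≥0)
    (hW : ∀ x : LaurentInfty F, W (algebraMap _ _ x) ≤ 1 ↔
        (Valued.v x : WithZero (Multiplicative ℤ)) ≤ 1)
    {u : UnitGroup F K}
    (hu : ∀ τ : K →ₐ[F⟮X⟯] AlgebraicClosure (LaurentInfty F),
      W (τ ((u : FunctionField.ringOfIntegers F K) : K)) ≤ 1) :
    u ∈ CommGroup.torsion (UnitGroup F K) := by
  classical
  -- Every power of u turns out to be a root of a polynomial of bounded degree with coefficients in
  -- the finite field F. There are finitely many such roots, so u has finite order.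
  have hfin := Polynomial.bUnion_roots_finite (algebraMap F[X] K) (Module.finrank F⟮X⟯ K)
    (Set.finite_range (Polynomial.C : F → F[X]))
  rw [CommGroup.mem_torsion, ← finite_powers]
  refine Set.Finite.of_finite_image (f := fun w : UnitGroup F K =>
    ((w : FunctionField.ringOfIntegers F K) : K)) (hfin.subset ?_)
    (fun a _ b _ hab => Units.ext (Subtype.ext hab))
  rintro _ ⟨w, ⟨n, rfl⟩, rfl⟩
  have hint : IsIntegral F[X] (((u ^ n : UnitGroup F K) : FunctionField.ringOfIntegers F K) : K) :=
    ((u ^ n : UnitGroup F K) : FunctionField.ringOfIntegers F K).2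
  have hle (τ : K →ₐ[F⟮X⟯] AlgebraicClosure (LaurentInfty F)) :
      W (τ (((u ^ n : UnitGroup F K) : FunctionField.ringOfIntegers F K) : K)) ≤ 1 := by
    simp only [Units.val_pow_eq_pow_val, SubmonoidClass.coe_pow, map_pow]
    exact pow_le_one₀ zero_le (hu τ)
  simp only at hint hle ⊢
  generalize (((u ^ n : UnitGroup F K) : FunctionField.ringOfIntegers F K) : K) = x at hint hle
  have hmin := minpoly.isIntegrallyClosed_eq_field_fractions' F⟮X⟯ hint
  have hxk : IsIntegral F⟮X⟯ x := Algebra.IsIntegral.isIntegral x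
  have : Module.IsTorsionFree F[X] K := by
    rw [Module.isTorsionFree_iff_algebraMap_injective, IsScalarTower.algebraMap_eq F[X] F⟮X⟯ K]
    exact (algebraMap F⟮X⟯ K).injective.comp (IsFractionRing.injective F[X] F⟮X⟯)
  simp only [Set.mem_iUnion]
  refine ⟨minpoly F[X] x, ⟨?_, fun i => ?_⟩, ?_⟩
  · rw [← (minpoly.monic hint).natDegree_map (algebraMap F[X] F⟮X⟯), ← hmin]
    exact minpoly.natDegree_le x
  -- A coefficient is a polynomial in t, and as a combination of conjugates it has valuation at most
  -- one at infinity. Its degree is therefore zero.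
  · set a := (minpoly F[X] x).coeff i with ha
    have hmem := coeff_mem_of_roots_mem W.integer
      ((minpoly.monic hxk).map (algebraMap F⟮X⟯ (AlgebraicClosure (LaurentInfty F))))
      (IsAlgClosed.splits _) (fun r hr => ?_) i
    · rw [Polynomial.coeff_map, hmin, Polynomial.coeff_map, ← ha, Valuation.mem_integer_iff,
        IsScalarTower.algebraMap_apply F⟮X⟯ (LaurentInfty F), hW] at hmem
      rcases eq_or_ne a 0 with h0 | h0
      · exact ⟨0, by simp [h0]⟩
      · rw [valuation_le_one_iff (by simpa using h0), degAtInfty_polynomial] at hmem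
        exact ⟨a.coeff 0, (Polynomial.eq_C_of_natDegree_le_zero (by exact_mod_cast hmem)).symm⟩
    · have : r ∈ (minpoly F⟮X⟯ x).rootSet (AlgebraicClosure (LaurentInfty F)) := by
        rw [Polynomial.rootSet, Finset.mem_coe, Multiset.mem_toFinset]
        exact hr
      rw [← Algebra.IsAlgebraic.range_eval_eq_rootSet_minpoly] at this
      obtain ⟨τ, rfl⟩ := this
      exact hle τ
  · exact Polynomial.mem_rootSet.2 ⟨minpoly.ne_zero hint, minpoly.aeval _ x⟩

end Units

/-! ### Galois conjugates and fundamental systems -/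

/-- The minimal polynomial has degree at least two and is separable, so it has a second root, and
automorphisms act transitively on the roots. -/
theorem exists_algEquiv_apply_ne {L Ω : Type*} [Field L] [Field Ω] [Algebra L Ω] [IsAlgClosure L Ω]
    {y : Ω} (hy : IsSeparable L y) (hy' : y ∉ (algebraMap L Ω).range) :
    ∃ g : Gal(Ω/L), g y ≠ y := by
  classical
  have : IsAlgClosed Ω := IsAlgClosure.isAlgClosed L
  have : Algebra.IsAlgebraic L Ω := IsAlgClosure.isAlgebraic
  have : Normal L Ω := IsAlgClosure.normal L Ω
  have hint : IsIntegral L y := hy.isIntegral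
  have hcard : Fintype.card ((minpoly L y).rootSet Ω) = (minpoly L y).natDegree :=
    Polynomial.card_rootSet_eq_natDegree hy (IsAlgClosed.splits _)
  have htwo : 2 ≤ (minpoly L y).natDegree := (minpoly.two_le_natDegree_iff hint).2 hy'
  have hmem : y ∈ (minpoly L y).rootSet Ω :=
    Polynomial.mem_rootSet.2 ⟨minpoly.ne_zero hint, minpoly.aeval _ _⟩
  obtain ⟨z, hz⟩ := Fintype.exists_ne_of_one_lt_card
    (by rw [← Nat.card_eq_fintype_card] at hcard ⊢; exact htwo.trans_eq hcard.symm) (⟨y, hmem⟩ : (minpoly L y).rootSet Ω)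
  obtain ⟨g, hg⟩ := minpoly.exists_algEquiv_of_root' hint.isAlgebraic
    (Polynomial.mem_rootSet.1 z.2).2
  exact ⟨g, hg ▸ fun h => hz (Subtype.ext h)⟩

theorem exists_algHom_of_forall_mem_range {k K L Ω : Type*} [Field k] [Field K] [Field L] [Field Ω]
    [Algebra k K] [Algebra k L] [Algebra k Ω] [Algebra L Ω] [IsScalarTower k L Ω]
    (τ : K →ₐ[k] Ω) (h : ∀ x, τ x ∈ (algebraMap L Ω).range) :
    ∃ σ : K →ₐ[k] L, ∀ x, algebraMap L Ω (σ x) = τ x := by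
  choose f hf using h
  have hinj := (algebraMap L Ω).injective
  refine ⟨⟨⟨⟨⟨f, ?_⟩, ?_⟩, ?_, ?_⟩, ?_⟩, hf⟩
  · apply hinj; simp [hf]
  · intro x y; apply hinj; simp [hf]
  · apply hinj; simp [hf]
  · intro x y; apply hinj; simp [hf]
  · intro x; apply hinj; simp [hf, ← IsScalarTower.algebraMap_apply]

/-- Since M is torsion-free, φ kills torsion and descends to the quotient. The hypothesis says that
nothing else is killed. -/
theorem exists_injective_linearMap_of_ker_le_torsion {G M : Type*} [CommGroup G] [AddCommGroup M]
    [IsAddTorsionFree M] (φ : G →* Multiplicative M)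
    (h : ∀ u, φ u = 1 → u ∈ CommGroup.torsion G) :
    ∃ f : Additive (G ⧸ CommGroup.torsion G) →ₗ[ℤ] M, Function.Injective f := by
  have hle : CommGroup.torsion G ≤ φ.ker := fun u hu => by
    have := MonoidHom.isOfFinOrder φ hu
    exact (isOfFinOrder_iff_eq_one _).1 this
  let f : G ⧸ CommGroup.torsion G →* Multiplicative M := QuotientGroup.lift _ φ hle
  refine ⟨(MonoidHom.toAdditiveLeft f).toIntLinearMap, ?_⟩
  rw [injective_iff_map_eq_zero]
  intro a ha
  obtain ⟨u, hu⟩ := QuotientGroup.mk_surjective a.toMul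
  have ha' : f a.toMul = 1 := ha
  rw [← hu] at ha'
  have := (QuotientGroup.eq_one_iff u).2 (h u ha')
  rw [hu] at this
  exact this

theorem exists_fundamentalSystem_of_basis {F K : Type*} [Field F] [Field K] [Algebra F[X] K] {r : ℕ}
    (b : Module.Basis (Fin r) ℤ
      (Additive (UnitGroup F K ⧸ CommGroup.torsion (UnitGroup F K)))) :
    ∃ ε : Fin r → UnitGroup F K, IsFundamentalSystem ε := by
  choose ε hε using fun i => QuotientGroup.mk_surjective (b i).toMul
  have key (n : Fin r → ℤ) : Additive.ofMul ((∏ i, ε i ^ n i : UnitGroup F K) :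
      UnitGroup F K ⧸ CommGroup.torsion (UnitGroup F K)) = ∑ i, n i • b i := by
    rw [← QuotientGroup.mk'_apply, map_prod, ofMul_prod]
    refine Finset.sum_congr rfl fun i _ => ?_
    rw [map_zpow, QuotientGroup.mk'_apply, hε]
    rfl
  refine ⟨ε, fun u => ?_⟩
  set a : Additive (UnitGroup F K ⧸ CommGroup.torsion (UnitGroup F K)) :=
    Additive.ofMul (u : UnitGroup F K ⧸ CommGroup.torsion (UnitGroup F K)) with ha
  have hu (n : Fin r → ℤ) : u * (∏ i, ε i ^ n i)⁻¹ ∈ CommGroup.torsion (UnitGroup F K) ↔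
      a = ∑ i, n i • b i := by
    rw [← key, ha, Additive.ofMul.apply_eq_iff_eq, ← QuotientGroup.eq_one_iff, QuotientGroup.mk_mul,
      QuotientGroup.mk_inv, mul_inv_eq_one]
  refine ⟨(⟨u * (∏ i, ε i ^ (b.repr a i))⁻¹, (hu _).2 (b.sum_repr a).symm⟩, b.repr a), ?_, ?_⟩
  · simp
  · rintro ⟨t, n⟩ h
    have hn : n = b.repr a := by
      have := (hu n).1 (by simp only [h]; simp)
      rw [this, b.repr_sum_self]
    subst hn
    refine Prod.ext (Subtype.ext ?_) rfl
    exact eq_mul_inv_of_mul_eq h.symm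

/-- A torsion product would have a second representation, itself times the zero exponents. -/
theorem IsFundamentalSystem.notMem_torsion {F K : Type*} [Field F] [Field K] [Algebra F[X] K] {r : ℕ}
    {ε : Fin r → UnitGroup F K} (hε : IsFundamentalSystem ε) {n : Fin r → ℤ} (hn : n ≠ 0) :
    ∏ i, ε i ^ n i ∉ CommGroup.torsion (UnitGroup F K) := by
  intro h
  have := (hε (∏ i, ε i ^ n i)).unique (y₁ := (⟨_, h⟩, 0)) (y₂ := (1, n)) (by simp) (by simp)
  exact hn (congrArg Prod.snd this).symm

/-! ### Complete splitting of the infinite place -/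

section Splitting

variable {F K : Type*} [Field F] [Field K] [Algebra F[X] K] [Algebra F⟮X⟯ K]
  [IsScalarTower F[X] F⟮X⟯ K]

open scoped NNReal

omit [Algebra F[X] K] [IsScalarTower F[X] F⟮X⟯ K] in
theorem exists_conjugate_of_notMem_range [Algebra.IsSeparable F⟮X⟯ K]
    (W : Valuation (AlgebraicClosure (LaurentInfty F)) ℝ≥0)
    (hW : ∀ (g : Gal(AlgebraicClosure (LaurentInfty F)/LaurentInfty F)) x, W (g x) = W x)
    (τ : K →ₐ[F⟮X⟯] AlgebraicClosure (LaurentInfty F)) {x : K}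
    (hx : τ x ∉ (algebraMap (LaurentInfty F) (AlgebraicClosure (LaurentInfty F))).range) :
    ∃ τ' : K →ₐ[F⟮X⟯] AlgebraicClosure (LaurentInfty F), τ' ≠ τ ∧ ∀ y, W (τ' y) = W (τ y) := by
  have hs : IsSeparable (LaurentInfty F) (τ x) :=
    
    IsSeparable.tower_top _ (IsSeparable.map τ τ.injective (Algebra.IsSeparable.isSeparable F⟮X⟯ x))
  obtain ⟨g, hg⟩ := exists_algEquiv_apply_ne hs hx
  refine ⟨(g.restrictScalars F⟮X⟯).toAlgHom.comp τ, fun h => hg ?_, fun y => hW g _⟩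
  exact congrArg (fun f : K →ₐ[F⟮X⟯] AlgebraicClosure (LaurentInfty F) => f x) h

theorem exists_third {α : Type*} [Fintype α] [DecidableEq α] (h : Fintype.card α = 3) {a b : α}
    (hab : a ≠ b) : ∃ c, c ≠ a ∧ c ≠ b ∧ (Finset.univ : Finset α) = {a, b, c} := by
  obtain ⟨c, -, hc⟩ := Finset.exists_mem_notMem_of_card_lt_card
    (s := {a, b}) (t := (Finset.univ : Finset α))
    (by rw [Finset.card_pair hab, Finset.card_univ, h]; norm_num)
  simp only [Finset.mem_insert, Finset.mem_singleton, not_or] at hc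
  refine ⟨c, hc.1, hc.2, (Finset.eq_univ_of_card _ ?_).symm⟩
  rw [h, Finset.card_eq_three]
  exact ⟨a, b, c, hab, Ne.symm hc.1, Ne.symm hc.2, rfl⟩

/-- If some embedding of `K` does not have its values in the field of Laurent series, then a single
degree map detects torsion units. -/
theorem exists_monoidHom_of_notMem_range [Finite F] [Algebra.IsSeparable F⟮X⟯ K]
    (hcubic : Module.finrank F⟮X⟯ K = 3)
    (τ₁ : K →ₐ[F⟮X⟯] AlgebraicClosure (LaurentInfty F)) {x : K}
    (hx : τ₁ x ∉ (algebraMap (LaurentInfty F) (AlgebraicClosure (LaurentInfty F))).range) :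
    ∃ φ : UnitGroup F K →* Multiplicative ℤ,
      ∀ u, φ u = 1 → u ∈ CommGroup.torsion (UnitGroup F K) := by
  classical
  have : FiniteDimensional F⟮X⟯ K := .of_finrank_pos (by omega)
  obtain ⟨W, hW, hWg⟩ := exists_valuation_algebraicClosure F
  have hcard : Fintype.card (K →ₐ[F⟮X⟯] AlgebraicClosure (LaurentInfty F)) = 3 := by
    rw [AlgHom.card, hcubic]
  obtain ⟨τ₂, h12, hW12⟩ := exists_conjugate_of_notMem_range W hWg τ₁ hx
  obtain ⟨τ₃, h31, h32, huniv⟩ := exists_third hcard h12.symm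
  have hprod (u : UnitGroup F K) :
      W (τ₁ ((u : FunctionField.ringOfIntegers F K) : K)) ^ 2 *
        W (τ₃ ((u : FunctionField.ringOfIntegers F K) : K)) = 1 := by
    have h := Algebra.norm_eq_prod_embeddings F⟮X⟯ (AlgebraicClosure (LaurentInfty F))
      ((u : FunctionField.ringOfIntegers F K) : K)
    have hn {c : F} (hc : c ≠ 0) : W (algebraMap F⟮X⟯ (AlgebraicClosure (LaurentInfty F))
        (algebraMap F[X] F⟮X⟯ (Polynomial.C c))) ≤ 1 := by
      rw [IsScalarTower.algebraMap_apply F⟮X⟯ (LaurentInfty F), hW,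
        valuation_le_one_iff (by simpa using hc), degAtInfty_polynomial]
      simp
    obtain ⟨c, hc, hc'⟩ := exists_norm_eq_C u
    have h1 : W (algebraMap F⟮X⟯ (AlgebraicClosure (LaurentInfty F))
        (Algebra.norm F⟮X⟯ ((u : FunctionField.ringOfIntegers F K) : K))) = 1 := by
      rw [hc']
      refine le_antisymm (hn hc) ?_
      -- Only the unit balls are known to agree, so valuation exactly one is obtained by bounding
      -- both c and c⁻¹.
      calc (1 : ℝ≥0) = W (algebraMap F⟮X⟯ (AlgebraicClosure (LaurentInfty F))
            (algebraMap F[X] F⟮X⟯ (Polynomial.C c))) * W (algebraMap F⟮X⟯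
            (AlgebraicClosure (LaurentInfty F)) (algebraMap F[X] F⟮X⟯ (Polynomial.C c⁻¹))) := by
              rw [← map_mul, ← map_mul, ← map_mul, ← Polynomial.C_mul, mul_inv_cancel₀ hc]
              simp
        _ ≤ _ := mul_le_of_le_one_right' (hn (inv_ne_zero hc))
    rw [h, huniv, Finset.prod_insert (by simp [h12.symm, h31.symm]),
      Finset.prod_pair h32.symm, map_mul, map_mul, hW12, ← mul_assoc, ← sq] at h1
    exact h1
  have htors {u : UnitGroup F K}
      (h1 : W (τ₁ ((u : FunctionField.ringOfIntegers F K) : K)) ≤ 1)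
      (h3 : W (τ₃ ((u : FunctionField.ringOfIntegers F K) : K)) ≤ 1) :
      u ∈ CommGroup.torsion (UnitGroup F K) := by
    refine mem_torsion_of_valuation_le_one W hW fun τ => ?_
    have hτ := Finset.mem_univ τ
    rw [huniv] at hτ
    simp only [Finset.mem_insert, Finset.mem_singleton] at hτ
    rcases hτ with rfl | rfl | rfl
    · exact h1
    · exact (hW12 _).trans_le h1
    · exact h3
  -- If τ₃ takes Laurent series values, its degree is the required integer-valued map, and the
  -- product relation recovers the other two valuations. Otherwise all three valuations agree, every
  -- unit is torsion, and the trivial map suffices.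
  by_cases h3 : ∀ y, τ₃ y ∈ (algebraMap (LaurentInfty F) (AlgebraicClosure (LaurentInfty F))).range
  · obtain ⟨σ, hσ⟩ := exists_algHom_of_forall_mem_range τ₃ h3
    refine ⟨unitDegree σ, fun u hu => ?_⟩
    have key {w : UnitGroup F K} (hw : unitDegree σ w = 1) :
        W (τ₃ ((w : FunctionField.ringOfIntegers F K) : K)) ≤ 1 := by
      rw [← hσ, hW, valuation_le_one_iff (by simp)]
      exact le_of_eq (congrArg Multiplicative.toAdd hw)
    have hinv := key (w := u⁻¹) (by rw [map_inv, hu, inv_one])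
    have h3u : W (τ₃ ((u : FunctionField.ringOfIntegers F K) : K)) = 1 := by
      refine le_antisymm (key hu) ?_
      have : W (τ₃ ((u : FunctionField.ringOfIntegers F K) : K)) *
          W (τ₃ (((u⁻¹ : UnitGroup F K) : FunctionField.ringOfIntegers F K) : K)) = 1 := by
        rw [← map_mul, ← map_mul, ← MulMemClass.coe_mul, Units.mul_inv]
        simp
      rw [← this]
      exact mul_le_of_le_one_right' hinv
    have h1 := hprod u
    rw [h3u, mul_one] at h1
    exact htors (pow_eq_one_iff_of_nonneg zero_le two_ne_zero |>.1 h1).le h3u.le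
  · push Not at h3
    obtain ⟨y, hy⟩ := h3
    obtain ⟨τ, hτ3, hWτ⟩ := exists_conjugate_of_notMem_range W hWg τ₃ hy
    have hW13 (z : K) : W (τ₃ z) = W (τ₁ z) := by
      have hτ := Finset.mem_univ τ
      rw [huniv] at hτ
      simp only [Finset.mem_insert, Finset.mem_singleton] at hτ
      rcases hτ with rfl | rfl | rfl
      · exact (hWτ z).symm
      · exact (hWτ z).symm.trans (hW12 z)
      · exact absurd rfl hτ3
    refine ⟨1, fun u _ => ?_⟩
    have h1 := hprod u
    rw [hW13, ← pow_succ] at h1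
    have h1 := (pow_eq_one_iff_of_nonneg zero_le (by norm_num) |>.1 h1).le
    exact htors h1 ((hW13 _).trans_le h1)

/-- In unit rank two the infinite place splits completely. -/
theorem mem_range_of_unitRank_eq_two [Finite F] [Algebra.IsSeparable F⟮X⟯ K]
    (hcubic : Module.finrank F⟮X⟯ K = 3) (hrank : unitRank F K = 2)
    (τ : K →ₐ[F⟮X⟯] AlgebraicClosure (LaurentInfty F)) (x : K) :
    τ x ∈ (algebraMap (LaurentInfty F) (AlgebraicClosure (LaurentInfty F))).range := by
  by_contra hx
  obtain ⟨φ, hφ⟩ := exists_monoidHom_of_notMem_range hcubic τ hx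
  obtain ⟨f, hf⟩ := exists_injective_linearMap_of_ker_le_torsion φ hφ
  have := LinearMap.finrank_le_finrank_of_injective hf
  rw [Module.finrank_self] at this
  rw [unitRank] at hrank
  omega

end Splitting

/-! ### Three Laurent embeddings and the discriminant of a unit -/

/-- Prime degree leaves no proper intermediate field, so x is either in k or a generator. In the
second case its image determines the embedding. -/
theorem mem_range_algebraMap_of_algHom_apply_eq {k K L : Type*} [Field k] [Field K] [Field L]
    [Algebra k K] [Algebra k L] (hp : (Module.finrank k K).Prime) {σ τ : K →ₐ[k] L} (hne : σ ≠ τ)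
    {x : K} (hx : σ x = τ x) : x ∈ (algebraMap k K).range := by
  have := IntermediateField.isSimpleOrder_of_finrank_prime k K hp
  have : FiniteDimensional k K := .of_finrank_pos hp.pos
  rcases eq_bot_or_eq_top (IntermediateField.adjoin k {x}) with h | h
  · exact IntermediateField.mem_bot.1 (IntermediateField.adjoin_simple_eq_bot_iff.1 h)
  · refine absurd ?_ hne
    have h' : Algebra.adjoin k {x} = ⊤ := by
      rw [← IntermediateField.adjoin_simple_toSubalgebra_of_isAlgebraic
        (Algebra.IsAlgebraic.isAlgebraic x), h, IntermediateField.top_toSubalgebra]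
    exact AlgHom.ext_of_adjoin_eq_top h' (by simpa using hx)

section Split

variable {F K : Type*} [Field F] [Field K] [Algebra F⟮X⟯ K]

/-- The matching indexing lets norm and discriminant formulas over the algebraic closure be read off
in the Laurent series field. -/
theorem exists_equiv_of_forall_mem_range [Algebra.IsSeparable F⟮X⟯ K]
    (hcubic : Module.finrank F⟮X⟯ K = 3)
    (hsplit : ∀ (τ : K →ₐ[F⟮X⟯] AlgebraicClosure (LaurentInfty F)) (x : K),
      τ x ∈ (algebraMap (LaurentInfty F) (AlgebraicClosure (LaurentInfty F))).range)
    {σ₀ σ₁ : K →ₐ[F⟮X⟯] LaurentInfty F} (hσ : σ₀ ≠ σ₁) :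
    ∃ (σ₂ : K →ₐ[F⟮X⟯] LaurentInfty F)
      (e : Fin 3 ≃ (K →ₐ[F⟮X⟯] AlgebraicClosure (LaurentInfty F))), ∀ i x,
        algebraMap (LaurentInfty F) (AlgebraicClosure (LaurentInfty F)) (![σ₀, σ₁, σ₂] i x) =
          e i x := by
  classical
  have : FiniteDimensional F⟮X⟯ K := .of_finrank_pos (by omega)
  have hcard : Fintype.card (K →ₐ[F⟮X⟯] AlgebraicClosure (LaurentInfty F)) = 3 := by
    rw [AlgHom.card, hcubic]
  let ι := IsScalarTower.toAlgHom F⟮X⟯ (LaurentInfty F) (AlgebraicClosure (LaurentInfty F))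
  have hne : ι.comp σ₀ ≠ ι.comp σ₁ := fun h => hσ <| AlgHom.ext fun x =>
    ι.injective (DFunLike.congr_fun h x)
  obtain ⟨τ, hτ₀, hτ₁, -⟩ := exists_third hcard hne
  obtain ⟨σ₂, hσ₂⟩ := exists_algHom_of_forall_mem_range τ (hsplit τ)
  have hinj : Function.Injective ![ι.comp σ₀, ι.comp σ₁, τ] := by
    intro i j
    fin_cases i <;> fin_cases j <;> simp [hne, hne.symm, hτ₀, hτ₀.symm, hτ₁, hτ₁.symm]
  refine ⟨σ₂, Equiv.ofBijective _ ((Fintype.bijective_iff_injective_and_card _).2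
    ⟨hinj, by rw [hcard, Fintype.card_fin]⟩), fun i x => ?_⟩
  fin_cases i
  · rfl
  · rfl
  · exact hσ₂ x

theorem exists_ne_of_forall_mem_range [Algebra.IsSeparable F⟮X⟯ K]
    (hcubic : Module.finrank F⟮X⟯ K = 3)
    (hsplit : ∀ (τ : K →ₐ[F⟮X⟯] AlgebraicClosure (LaurentInfty F)) (x : K),
      τ x ∈ (algebraMap (LaurentInfty F) (AlgebraicClosure (LaurentInfty F))).range) :
    ∃ σ₀ σ₁ : K →ₐ[F⟮X⟯] LaurentInfty F, σ₀ ≠ σ₁ := by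
  have : FiniteDimensional F⟮X⟯ K := .of_finrank_pos (by omega)
  have hcard : Fintype.card (K →ₐ[F⟮X⟯] AlgebraicClosure (LaurentInfty F)) = 3 := by
    rw [AlgHom.card, hcubic]
  obtain ⟨τ₀, τ₁, hne⟩ := Fintype.exists_pair_of_one_lt_card (by omega :
    1 < Fintype.card (K →ₐ[F⟮X⟯] AlgebraicClosure (LaurentInfty F)))
  obtain ⟨σ₀, h₀⟩ := exists_algHom_of_forall_mem_range τ₀ (hsplit τ₀)
  obtain ⟨σ₁, h₁⟩ := exists_algHom_of_forall_mem_range τ₁ (hsplit τ₁)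
  exact ⟨σ₀, σ₁, fun h => hne (AlgHom.ext fun x => by rw [← h₀, ← h₁, h])⟩

variable [Algebra F[X] K] [IsScalarTower F[X] F⟮X⟯ K]

theorem sum_degAtInfty_eq_zero [FiniteDimensional F⟮X⟯ K] [Algebra.IsSeparable F⟮X⟯ K]
    (s : Fin 3 → (K →ₐ[F⟮X⟯] LaurentInfty F))
    (e : Fin 3 ≃ (K →ₐ[F⟮X⟯] AlgebraicClosure (LaurentInfty F)))
    (he : ∀ i x, algebraMap (LaurentInfty F) (AlgebraicClosure (LaurentInfty F)) (s i x) = e i x)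
    (u : UnitGroup F K) :
    degAtInfty (s 0 ((u : FunctionField.ringOfIntegers F K) : K)) +
      degAtInfty (s 1 ((u : FunctionField.ringOfIntegers F K) : K)) +
      degAtInfty (s 2 ((u : FunctionField.ringOfIntegers F K) : K)) = 0 := by
  obtain ⟨c, hc, hc'⟩ := exists_norm_eq_C u
  have h := Algebra.norm_eq_prod_embeddings F⟮X⟯ (AlgebraicClosure (LaurentInfty F))
      ((u : FunctionField.ringOfIntegers F K) : K)
  rw [← e.prod_comp, hc', IsScalarTower.algebraMap_apply F⟮X⟯ (LaurentInfty F)] at h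
  simp_rw [← he] at h
  rw [← map_prod, Fin.prod_univ_three] at h
  have h := congrArg degAtInfty ((algebraMap (LaurentInfty F) _).injective h)
  rw [degAtInfty_polynomial, Polynomial.natDegree_C, degAtInfty_mul (by simp) (by simp),
    degAtInfty_mul (by simp) (by simp)] at h
  exact h.symm

theorem mem_torsion_of_degAtInfty_le_zero [Finite F] [FiniteDimensional F⟮X⟯ K]
    (s : Fin 3 → (K →ₐ[F⟮X⟯] LaurentInfty F))
    (e : Fin 3 ≃ (K →ₐ[F⟮X⟯] AlgebraicClosure (LaurentInfty F)))
    (he : ∀ i x, algebraMap (LaurentInfty F) (AlgebraicClosure (LaurentInfty F)) (s i x) = e i x)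
    {u : UnitGroup F K}
    (hu : ∀ i, degAtInfty (s i ((u : FunctionField.ringOfIntegers F K) : K)) ≤ 0) :
    u ∈ CommGroup.torsion (UnitGroup F K) := by
  obtain ⟨W, hW, -⟩ := exists_valuation_algebraicClosure F
  refine mem_torsion_of_valuation_le_one W hW fun τ => ?_
  obtain ⟨i, rfl⟩ := e.surjective τ
  rw [← he, hW, valuation_le_one_iff (by simp)]
  exact hu i

/-- If two conjugates coincide, u lies in F(t). Its three degrees are then equal with sum zero,
hence all zero, and u is torsion. -/
theorem apply_injective_of_notMem_torsion [Finite F] [Algebra.IsSeparable F⟮X⟯ K]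
    (hcubic : Module.finrank F⟮X⟯ K = 3)
    (s : Fin 3 → (K →ₐ[F⟮X⟯] LaurentInfty F))
    (e : Fin 3 ≃ (K →ₐ[F⟮X⟯] AlgebraicClosure (LaurentInfty F)))
    (he : ∀ i x, algebraMap (LaurentInfty F) (AlgebraicClosure (LaurentInfty F)) (s i x) = e i x)
    {u : UnitGroup F K} (hu : u ∉ CommGroup.torsion (UnitGroup F K)) :
    Function.Injective fun i => s i ((u : FunctionField.ringOfIntegers F K) : K) := by
  have : FiniteDimensional F⟮X⟯ K := .of_finrank_pos (by omega)
  intro i j hij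
  by_contra hne
  have hs : s i ≠ s j := fun h => hne <| e.injective <| AlgHom.ext fun x => by
    rw [← he, ← he, h]
  obtain ⟨y, hy⟩ := mem_range_algebraMap_of_algHom_apply_eq
    (hcubic ▸ Nat.prime_three) hs hij
  have hsum := sum_degAtInfty_eq_zero s e he u
  refine hu (mem_torsion_of_degAtInfty_le_zero s e he fun l => ?_)
  simp only [← hy, AlgHom.commutes] at hsum ⊢
  omega

/-- The discriminant of `1, u, u²` is a square multiple of the field discriminant. -/
theorem exists_sq_mul_eq_prod [Algebra.IsSeparable F⟮X⟯ K]
    (hcubic : Module.finrank F⟮X⟯ K = 3)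
    (s : Fin 3 → (K →ₐ[F⟮X⟯] LaurentInfty F))
    (e : Fin 3 ≃ (K →ₐ[F⟮X⟯] AlgebraicClosure (LaurentInfty F)))
    (he : ∀ i x, algebraMap (LaurentInfty F) (AlgebraicClosure (LaurentInfty F)) (s i x) = e i x)
    {D : F[X]} (hD : IsDiscriminant F K D) (x : FunctionField.ringOfIntegers F K) :
    ∃ q : F[X], algebraMap F⟮X⟯ (LaurentInfty F) (algebraMap F[X] F⟮X⟯ (q ^ 2 * D)) =
      ((s 1 (x : K) - s 0 (x : K)) * (s 2 (x : K) - s 0 (x : K)) *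
        (s 2 (x : K) - s 1 (x : K))) ^ 2 := by
  have : FiniteDimensional F⟮X⟯ K := .of_finrank_pos (by omega)
  obtain ⟨b, rfl⟩ := hD
  let b' := b.reindex (finCongr hcubic)
  have hb : Algebra.discr F[X] b = Algebra.discr F[X] b' := by
    rw [← Algebra.discr_reindex F[X] b (finCongr hcubic)]
    congr 1
    ext i
    simp [b']
  have hloc : IsLocalization (Algebra.algebraMapSubmonoid (FunctionField.ringOfIntegers F K)
      (nonZeroDivisors F[X])) K := IsIntegralClosure.isLocalization F[X] F⟮X⟯ K _
  -- P expresses 1, x, x² in the integral basis, so the Vandermonde discriminant is D multiplied by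
  -- the square of det P.
  let P : Matrix (Fin 3) (Fin 3) F[X] := fun i j => b'.repr (x ^ (j : ℕ)) i
  let B := b'.localizationLocalization F⟮X⟯ (nonZeroDivisors F[X]) K
  refine ⟨P.det, (algebraMap (LaurentInfty F) (AlgebraicClosure (LaurentInfty F))).injective ?_⟩
  have hP : Matrix.vecMul B ((P.map (algebraMap F[X] F⟮X⟯)).map (algebraMap F⟮X⟯ K)) =
      fun j : Fin 3 => (x : K) ^ (j : ℕ) := by
    ext j
    have := congrArg (algebraMap (FunctionField.ringOfIntegers F K) K)
      (b'.sum_repr (x ^ (j : ℕ)))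
    rw [map_sum] at this
    rw [Matrix.vecMul, dotProduct]
    refine Eq.trans (Finset.sum_congr rfl fun i _ => ?_) this
    rw [Algebra.smul_def, map_mul, mul_comm, Module.Basis.localizationLocalization_apply,
      Matrix.map_apply, Matrix.map_apply, ← IsScalarTower.algebraMap_apply,
      ← IsScalarTower.algebraMap_apply]
  have hdisc := Algebra.discr_of_matrix_vecMul (A := F⟮X⟯) B (P.map (algebraMap F[X] F⟮X⟯))
  rw [hP, Algebra.discr_localizationLocalization, ← RingHom.mapMatrix_apply, ← RingHom.map_det,
    ← map_pow, ← map_mul, ← hb] at hdisc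
  rw [← hdisc, ← IsScalarTower.algebraMap_apply,
    Algebra.discr_eq_det_embeddingsMatrixReindex_pow_two F⟮X⟯ _ _ e, map_pow]
  congr 1
  have hV : Algebra.embeddingsMatrixReindex F⟮X⟯ (AlgebraicClosure (LaurentInfty F))
      (fun j : Fin 3 => (x : K) ^ (j : ℕ)) e =
      (Matrix.vandermonde fun i => algebraMap (LaurentInfty F) (AlgebraicClosure (LaurentInfty F))
        (s i (x : K))).transpose := by
    ext i j
    simp [Algebra.embeddingsMatrixReindex, Matrix.vandermonde, he]
  rw [hV, Matrix.det_transpose, Matrix.det_vandermonde]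
  simp [Fin.prod_univ_three, show Finset.Ioi (1 : Fin 3) = {2} from rfl,
    show Finset.Ioi (2 : Fin 3) = ∅ from rfl]

/-- The factor q² has nonnegative degree, and each difference of conjugates obeys the ultrametric
bound. Distinct conjugates make the discriminant nonzero, so degrees add. -/
theorem natDegree_discr_le [Finite F] [Algebra.IsSeparable F⟮X⟯ K]
    (hcubic : Module.finrank F⟮X⟯ K = 3)
    (s : Fin 3 → (K →ₐ[F⟮X⟯] LaurentInfty F))
    (e : Fin 3 ≃ (K →ₐ[F⟮X⟯] AlgebraicClosure (LaurentInfty F)))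
    (he : ∀ i x, algebraMap (LaurentInfty F) (AlgebraicClosure (LaurentInfty F)) (s i x) = e i x)
    {D : F[X]} (hD : IsDiscriminant F K D)
    {u : UnitGroup F K} (hu : u ∉ CommGroup.torsion (UnitGroup F K)) :
    (D.natDegree : ℤ) ≤
      2 * (max (degAtInfty (s 1 ((u : FunctionField.ringOfIntegers F K) : K)))
          (degAtInfty (s 0 ((u : FunctionField.ringOfIntegers F K) : K))) +
        max (degAtInfty (s 2 ((u : FunctionField.ringOfIntegers F K) : K)))
          (degAtInfty (s 0 ((u : FunctionField.ringOfIntegers F K) : K))) +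
        max (degAtInfty (s 2 ((u : FunctionField.ringOfIntegers F K) : K)))
          (degAtInfty (s 1 ((u : FunctionField.ringOfIntegers F K) : K)))) := by
  have hinj := apply_injective_of_notMem_torsion hcubic s e he hu
  obtain ⟨q, hq⟩ := exists_sq_mul_eq_prod hcubic s e he hD (u : FunctionField.ringOfIntegers F K)
  have hne {i j : Fin 3} (hij : i ≠ j) : s i ((u : FunctionField.ringOfIntegers F K) : K) ≠
      s j ((u : FunctionField.ringOfIntegers F K) : K) := hinj.ne hij
  have hle {i j : Fin 3} (hij : i ≠ j) := degAtInfty_sub_le (F := F)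
    (x := s i ((u : FunctionField.ringOfIntegers F K) : K))
    (y := s j ((u : FunctionField.ringOfIntegers F K) : K)) (by simp) (by simp) (hne hij)
  have h10 := sub_ne_zero.2 (hne (i := 1) (j := 0) (by decide))
  have h20 := sub_ne_zero.2 (hne (i := 2) (j := 0) (by decide))
  have h21 := sub_ne_zero.2 (hne (i := 2) (j := 1) (by decide))
  have hqD : q ^ 2 * D ≠ 0 := by
    intro h
    rw [h, map_zero, map_zero] at hq
    exact pow_ne_zero 2 (mul_ne_zero (mul_ne_zero h10 h20) h21) hq.symm
  have hdeg := congrArg degAtInfty hq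
  rw [degAtInfty_polynomial, Polynomial.natDegree_mul (left_ne_zero_of_mul hqD)
    (right_ne_zero_of_mul hqD), sq (_ * _ * _), degAtInfty_mul (by simp [*]) (by simp [*]),
    degAtInfty_mul (by simp [*]) (by simp [*]), degAtInfty_mul (by simp [*]) (by simp [*])] at hdeg
  have a := hle (i := 1) (j := 0) (by decide)
  have b := hle (i := 2) (j := 0) (by decide)
  have c := hle (i := 2) (j := 1) (by decide)
  push_cast at hdeg
  linarith [Int.natCast_nonneg (q ^ 2).natDegree]

end Split

/-! ### Minkowski's theorem for the hexagon -/

open MeasureTheory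

/-- The hexagon of vectors `(u, v)` for which `u`, `v`, `u - v` are less than `m` in absolute
value. -/
def hexagon (m : ℝ) : Set (Fin 2 → ℝ) := {p | |p 0| < m ∧ |p 1| < m ∧ |p 0 - p 1| < m}

theorem convex_hexagon (m : ℝ) : Convex ℝ (hexagon m) := by
  have h (f : (Fin 2 → ℝ) →ₗ[ℝ] ℝ) : Convex ℝ {p | |f p| < m} := by
    have : {p | |f p| < m} = f ⁻¹' Metric.ball 0 m := by ext p; simp
    rw [this]
    exact (convex_ball 0 m).linear_preimage f
  let f₀ : (Fin 2 → ℝ) →ₗ[ℝ] ℝ := LinearMap.proj 0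
  let f₁ : (Fin 2 → ℝ) →ₗ[ℝ] ℝ := LinearMap.proj 1
  exact (h f₀).inter ((h f₁).inter (h (f₀ - f₁)))

theorem volume_hexagon {m : ℝ} (hm : 0 ≤ m) : volume (hexagon m) = ENNReal.ofReal (3 * m ^ 2) := by
  have hmp := volume_preserving_finTwoArrow ℝ
  have hpre : hexagon m = MeasurableEquiv.finTwoArrow ⁻¹'
      regionBetween (fun x => max (-m) (x - m)) (fun x => min m (x + m)) (Set.Ioo (-m) m) := by
    ext p
    simp only [hexagon, regionBetween, Set.mem_preimage, Set.mem_ofPred_eq, Set.mem_Ioo, abs_lt,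
      MeasurableEquiv.finTwoArrow_apply, max_lt_iff, lt_min_iff]
    constructor
    · rintro ⟨⟨h1, h2⟩, ⟨h3, h4⟩, h5, h6⟩
      exact ⟨⟨h1, h2⟩, ⟨h3, by linarith⟩, h4, by linarith⟩
    · rintro ⟨⟨h1, h2⟩, ⟨h3, h4⟩, h5, h6⟩
      exact ⟨⟨h1, h2⟩, ⟨h3, h5⟩, by linarith, by linarith⟩
  have hc1 : Continuous fun x : ℝ => max (-m) (x - m) := by fun_prop
  have hc2 : Continuous fun x : ℝ => min m (x + m) := by fun_prop
  rw [hpre, hmp.measure_preimage_equiv, Measure.volume_eq_prod, volume_regionBetween_eq_integral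
    (hc1.integrableOn_Icc.mono_set Set.Ioo_subset_Icc_self)
    (hc2.integrableOn_Icc.mono_set Set.Ioo_subset_Icc_self) measurableSet_Ioo]
  · congr 1
    rw [← integral_Ioc_eq_integral_Ioo, ← intervalIntegral.integral_of_le (by linarith),
      ← intervalIntegral.integral_add_adjacent_intervals (b := 0)
        ((hc2.sub hc1).intervalIntegrable _ _) ((hc2.sub hc1).intervalIntegrable _ _)]
    -- The bounding functions switch branch at 0, so the slice length is x + 2m to the left and 2m −
    -- x to the right.
    have h1 : ∫ x in (-m)..0, ((fun x : ℝ => min m (x + m)) - fun x => max (-m) (x - m)) x =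
        ∫ x in (-m)..0, (x + 2 * m) := by
      refine intervalIntegral.integral_congr fun x hx => ?_
      rw [Set.uIcc_of_le (by linarith), Set.mem_Icc] at hx
      simp only [Pi.sub_apply]
      rw [min_eq_right (by linarith), max_eq_left (by linarith)]
      ring
    have h2 : ∫ x in (0 : ℝ)..m, ((fun x : ℝ => min m (x + m)) - fun x => max (-m) (x - m)) x =
        ∫ x in (0 : ℝ)..m, (2 * m - x) := by
      refine intervalIntegral.integral_congr fun x hx => ?_
      rw [Set.uIcc_of_le hm, Set.mem_Icc] at hx
      simp only [Pi.sub_apply]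
      rw [min_eq_left (by linarith), max_eq_right (by linarith)]
      ring
    rw [h1, h2, intervalIntegral.integral_add (by simp) (by simp),
      intervalIntegral.integral_sub (by simp) (by simp)]
    simp
    ring
  · intro x hx
    simp only [max_le_iff, le_min_iff]
    refine ⟨⟨?_, ?_⟩, ?_, ?_⟩ <;> linarith [hx.1, hx.2]

/-- A plane lattice without nonzero points in the hexagon of size `m` has covolume at least
`3 / 4 * m ^ 2`. -/
theorem le_abs_det_of_forall_notMem_hexagon {m : ℝ} (hm : 0 ≤ m) (A : Matrix (Fin 2) (Fin 2) ℝ)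
    (hdet : A.det ≠ 0) (h : ∀ n : Fin 2 → ℤ, n ≠ 0 → ∑ i, (n i : ℝ) • A i ∉ hexagon m) :
    3 / 4 * m ^ 2 ≤ |A.det| := by
  by_contra! hlt
  have hli : LinearIndependent ℝ A.row := Matrix.linearIndependent_rows_of_det_ne_zero hdet
  let b : Module.Basis (Fin 2) ℝ (Fin 2 → ℝ) :=
    basisOfLinearIndependentOfCardEqFinrank hli (by simp)
  have hb : (b : Fin 2 → Fin 2 → ℝ) = A := by
    rw [coe_basisOfLinearIndependentOfCardEqFinrank]
    rfl
  have hvol : volume (ZSpan.fundamentalDomain b) = ENNReal.ofReal |A.det| := by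
    rw [ZSpan.volume_fundamentalDomain, hb]
    rfl
  have : Countable (Submodule.span ℤ (Set.range b)).toAddSubgroup :=
    inferInstanceAs (Countable (Submodule.span ℤ (Set.range b)))
  obtain ⟨x, hx0, hx⟩ := exists_ne_zero_mem_lattice_of_measure_mul_two_pow_lt_measure
    (L := (Submodule.span ℤ (Set.range b)).toAddSubgroup) (μ := volume)
    (s := hexagon m) (ZSpan.isAddFundamentalDomain' b volume)
    (fun p hp => by
      simp only [hexagon, Set.mem_ofPred_eq, Pi.neg_apply, abs_neg] at hp ⊢
      rwa [← neg_sub', abs_neg])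
    (convex_hexagon m)
    (by
      rw [hvol, volume_hexagon hm, Module.finrank_fin_fun,
        show (2 : ENNReal) ^ 2 = ENNReal.ofReal 4 by norm_num,
        ← ENNReal.ofReal_mul (abs_nonneg _)]
      exact (ENNReal.ofReal_lt_ofReal_iff_of_nonneg (by positivity)).2 (by linarith))
  obtain ⟨n, hn⟩ := Submodule.mem_span_range_iff_exists_fun ℤ |>.1 x.2
  refine h n ?_ ?_
  · rintro rfl
    exact hx0 (Subtype.ext (by simpa using hn.symm))
  · rw [← hn, hb] at hx
    simpa only [Int.cast_smul_eq_zsmul] using hx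

/-! ### The regulator bound -/

section Regulator

variable {F K : Type*} [Field F] [Field K] [Algebra F[X] K] [Algebra F⟮X⟯ K]

theorem degAtInfty_prod_zpow {r : ℕ} (σ : K →ₐ[F⟮X⟯] LaurentInfty F) (ε : Fin r → UnitGroup F K)
    (n : Fin r → ℤ) :
    degAtInfty (σ (((∏ i, ε i ^ n i : UnitGroup F K) : FunctionField.ringOfIntegers F K) : K)) =
      ∑ i, n i * degAtInfty (σ ((ε i : FunctionField.ringOfIntegers F K) : K)) := by
  have h : unitDegree σ (∏ i, ε i ^ n i) = ∏ i, unitDegree σ (ε i) ^ n i := by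
    simp only [map_prod, map_zpow]
  have h := congrArg Multiplicative.toAdd h
  rw [toAdd_prod] at h
  simp only [toAdd_zpow, smul_eq_mul] at h
  exact h

variable [IsScalarTower F[X] F⟮X⟯ K]

theorem sq_natDegree_le_of_isRegulator [Finite F] [Algebra.IsSeparable F⟮X⟯ K]
    (hcubic : Module.finrank F⟮X⟯ K = 3)
    (hsplit : ∀ (τ : K →ₐ[F⟮X⟯] AlgebraicClosure (LaurentInfty F)) (x : K),
      τ x ∈ (algebraMap (LaurentInfty F) (AlgebraicClosure (LaurentInfty F))).range)
    {D : F[X]} (hD : IsDiscriminant F K D) {R : ℤ} (hR : IsRegulator F K R) :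
    (1 / 16 : ℝ) * (D.natDegree : ℝ) ^ 2 ≤ (R : ℝ) := by
  have : FiniteDimensional F⟮X⟯ K := .of_finrank_pos (by omega)
  obtain ⟨ε, σ, hε, hσ, rfl⟩ := hR
  obtain ⟨σ₂, e, he⟩ := exists_equiv_of_forall_mem_range hcubic hsplit hσ
  set M := degreeMatrix ε σ
  have hdeg (n : Fin 2 → ℤ) (j : Fin 2) : degAtInfty (σ j (((∏ i, ε i ^ n i : UnitGroup F K) :
      FunctionField.ringOfIntegers F K) : K)) = n 0 * M 0 j + n 1 * M 1 j := by
    rw [degAtInfty_prod_zpow, Fin.sum_univ_two]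
    rfl
  -- A singular integer matrix has a nonzero integer relation n. The matching unit has degree zero
  -- in two embeddings, hence in the third, so it would be torsion.
  have hdet : M.det ≠ 0 := by
    intro h0
    obtain ⟨n, hn, hnM⟩ := Matrix.exists_vecMul_eq_zero_iff.2 h0
    have hz (j : Fin 2) : n 0 * M 0 j + n 1 * M 1 j = 0 := by
      have := congrFun hnM j
      rwa [Matrix.vecMul, dotProduct, Fin.sum_univ_two] at this
    refine hε.notMem_torsion hn (mem_torsion_of_degAtInfty_le_zero _ e he fun i => ?_)
    have hsum := sum_degAtInfty_eq_zero _ e he (∏ i, ε i ^ n i)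
    have h0 := hdeg n 0
    have h1 := hdeg n 1
    rw [hz] at h0 h1
    simp only [Matrix.cons_val_zero, Matrix.cons_val_one, Matrix.cons_val, h0, h1] at hsum
    fin_cases i
    · exact h0.le
    · exact h1.le
    · simp only [Fin.reduceFinMk, Matrix.cons_val]
      omega
  -- With z = −x − y, the rows are (x − z, y − z) for the two fundamental units. The change of
  -- coordinates has determinant 3.
  let A : Matrix (Fin 2) (Fin 2) ℝ :=
    !![2 * M 0 0 + M 0 1, M 0 0 + 2 * M 0 1; 2 * M 1 0 + M 1 1, M 1 0 + 2 * M 1 1]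
  have hA : A.det = 3 * (M.det : ℝ) := by
    rw [Matrix.det_fin_two_of, Matrix.det_fin_two]
    push_cast
    ring
  have hle := le_abs_det_of_forall_notMem_hexagon (m := (D.natDegree : ℝ) / 2) (by positivity) A
    (by rw [hA]; exact mul_ne_zero three_ne_zero (Int.cast_ne_zero.2 hdet)) (fun n hn hmem => by
      -- Membership in the hexagon says that all pairwise differences of x, y, z are below deg D /
      -- 2, against the discriminant bound.
      have h := natDegree_discr_le hcubic _ e he hD (hε.notMem_torsion hn)
      have hsum := sum_degAtInfty_eq_zero _ e he (∏ i, ε i ^ n i)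
      simp only [Matrix.cons_val_zero, Matrix.cons_val_one, Matrix.cons_val] at h hsum
      have h0 := hdeg n 0
      have h1 := hdeg n 1
      generalize degAtInfty (σ 0 (((∏ i, ε i ^ n i : UnitGroup F K) :
        FunctionField.ringOfIntegers F K) : K)) = x at *
      generalize degAtInfty (σ 1 (((∏ i, ε i ^ n i : UnitGroup F K) :
        FunctionField.ringOfIntegers F K) : K)) = y at *
      generalize degAtInfty (σ₂ (((∏ i, ε i ^ n i : UnitGroup F K) :
        FunctionField.ringOfIntegers F K) : K)) = z at *
      have e0 : (∑ i, (n i : ℝ) • A i) 0 = ((2 * x + y : ℤ) : ℝ) := by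
        simp [Fin.sum_univ_two, A, h0, h1]
        ring
      have e1 : (∑ i, (n i : ℝ) • A i) 1 = ((x + 2 * y : ℤ) : ℝ) := by
        simp [Fin.sum_univ_two, A, h0, h1]
        ring
      obtain ⟨b1, b2, b3⟩ := hmem
      rw [e0, e1, ← Int.cast_sub] at b3
      rw [e0] at b1
      rw [e1] at b2
      rw [lt_div_iff₀ two_pos] at b1 b2 b3
      norm_cast at b1 b2 b3
      rw [abs_eq_max_neg] at b1 b2 b3
      omega)
  rw [hA, abs_mul, abs_of_pos (three_pos : (0 : ℝ) < 3)] at hle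
  rw [Int.cast_abs]
  linarith

/-- This rules out the default value 0 of `regulator`. The degrees embed units modulo torsion in ℤ³,
so that quotient is free and finitely generated, and rank two yields a basis. -/
theorem exists_isRegulator [Finite F] [Algebra.IsSeparable F⟮X⟯ K]
    (hcubic : Module.finrank F⟮X⟯ K = 3) (hrank : unitRank F K = 2)
    (hsplit : ∀ (τ : K →ₐ[F⟮X⟯] AlgebraicClosure (LaurentInfty F)) (x : K),
      τ x ∈ (algebraMap (LaurentInfty F) (AlgebraicClosure (LaurentInfty F))).range) :
    ∃ R, IsRegulator F K R := by
  have : FiniteDimensional F⟮X⟯ K := .of_finrank_pos (by omega)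
  obtain ⟨σ₀, σ₁, hσ⟩ := exists_ne_of_forall_mem_range hcubic hsplit
  obtain ⟨σ₂, e, he⟩ := exists_equiv_of_forall_mem_range hcubic hsplit hσ
  let φ : UnitGroup F K →* Multiplicative (Fin 3 → ℤ) :=
    { toFun u := .ofAdd fun i => (unitDegree (![σ₀, σ₁, σ₂] i) u).toAdd
      map_one' := by ext; simp
      map_mul' u w := by ext; simp }
  obtain ⟨f, hf⟩ := exists_injective_linearMap_of_ker_le_torsion φ fun u hu =>
    mem_torsion_of_degAtInfty_le_zero _ e he fun i => le_of_eq <|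
      congrFun (congrArg Multiplicative.toAdd hu) i
  have : Module.Free ℤ (Additive (UnitGroup F K ⧸ CommGroup.torsion (UnitGroup F K))) :=
    .of_equiv (LinearEquiv.ofInjective f hf).symm
  have : Module.Finite ℤ (Additive (UnitGroup F K ⧸ CommGroup.torsion (UnitGroup F K))) :=
    .equiv (LinearEquiv.ofInjective f hf).symm
  obtain ⟨ε, hε⟩ := exists_fundamentalSystem_of_basis
    (Module.finBasisOfFinrankEq ℤ _ hrank)
  exact ⟨_, ε, ![σ₀, σ₁], hε, by simpa using hσ, rfl⟩

end Regulator

end CubicFunctionField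

theorem mainTheorem6 (F K : Type*) [Field F] [Finite F] (hchar : 5 ≤ ringChar F)
    [Field K] [Algebra F[X] K] [Algebra F⟮X⟯ K] [IsScalarTower F[X] F⟮X⟯ K]
    (hcubic : Module.finrank F⟮X⟯ K = 3)
    (hrank : CubicFunctionField.unitRank F K = 2)
    (D : F[X]) (hD : CubicFunctionField.IsDiscriminant F K D) :
    (1 / 16 : ℝ) * (D.natDegree : ℝ) ^ 2 ≤ (CubicFunctionField.regulator F K : ℝ) := by
  have := CubicFunctionField.isSeparable_of_finrank_eq_three (K := K) hchar hcubic
  have hsplit := CubicFunctionField.mem_range_of_unitRank_eq_two (K := K) hcubic hrank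
  have hex := CubicFunctionField.exists_isRegulator (K := K) hcubic hrank hsplit
  -- The bound holds for every admissible R, so the value selected by choice is immaterial.
  rw [CubicFunctionField.regulator, dif_pos hex]
  exact CubicFunctionField.sq_natDegree_le_of_isRegulator hcubic hsplit hD hex.choose_spec
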